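/- Let $X$ be a finite-dimensional real normed space and let $G=(V,E)$ be a finite simple graph. A placement of $G$ is a map $p:V\to X$, and the pair $(G,p)$ is a framework in $X$. Let $f_G:X^V\to\mathbb{R}^E$, $p\mapsto(\|p_v-p_w\|)_{vw\in E}$, be the rigidity map. Placements $p,q$ are congruent if $q=g\circ p$ for some isometry $g:X\to X$ (a bijective distance-preserving map), and frameworks $(G,p),(G,q)$ are equivalent if $f_G(p)=f_G(q)$. Let $\operatorname{Isom}(X)$ be the Lie group of isometries of $X$, and let $\mathcal{T}(p)=\{g\circ p : g:X\to X \text{ lies in the tangent space of } \operatorname{Isom}(X) \text{ at the identity}\}$, i.e. $g$ ranges over the velocities at time $0$ of smooth curves in $\operatorname{Isom}(X)$ that are at the identity at time $0$. A framework $(G,p)$ is - well-positioned if $f_G$ is Fréchet differentiable at $p$; - infinitesimally rigid if every $u\in X^V$ with $\lim_{t\to0}\frac1t\big(f_G(p+tu)-f_G(p)\big)=0$ lies in $\mathcal{T}(p)$; - strongly infinitesimally rigid if $\ker A=\mathcal{T}(p)$ for every generalised derivative $A$ of $f_G$ at $p$, i.e. for every $A$ in the convex hull of the set of all limits $\lim_{n\to\infty}df_G(x_n)$,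 where $x_n\to p$ and $f_G$ is differentiable at each $x_n$; - locally rigid if there is $\delta>0$ such that every framework $(G,q)$ equivalent to $(G,p)$ with $\|q_v-p_v\|<\delta$ for all $v\in V$ has $q$ congruent to $p$; - continuously rigid if for every continuous $\gamma:[0,1]\to X^V$ with $\gamma(0)=p$ and $f_G(\gamma(t))=f_G(p)$ for all $t$, each $\gamma(t)$ is congruent to $p$. Suppose that $(G,p)$ is a well-positioned and infinitesimally rigid framework in $X$. Then there exists $\varepsilon>0$ such that every framework $(G,q)$ in $X$ with $\|p_v-q_v\|<\varepsilon$ for all $v\in V$ is strongly infinitesimally rigid, infinitesimally rigid, locally rigid and continuously rigid. -/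

import Mathlib

open Filter Topology
open scoped ContDiff

namespace BarJoint

section GeneralisedDerivative

variable {E F : Type*} [NormedAddCommGroup E] [NormedSpace ℝ E]
  [NormedAddCommGroup F] [NormedSpace ℝ F]

/-- All limits of derivatives `df (x n)` along sequences `x n → x` of points at which `f` is
(Fréchet) differentiable. -/
def derivLimits (f : E → F) (x : E) : Set (E →L[ℝ] F) :=
  {A | ∃ u : ℕ → E, Tendsto u atTop (𝓝 x) ∧ (∀ n, DifferentiableAt ℝ f (u n)) ∧
    Tendsto (fun n => fderiv ℝ f (u n)) atTop (𝓝 A)}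

/-- The (Clarke) generalised derivatives of `f` at `x`: the convex hull of the limits of
derivatives of `f` at nearby points of differentiability. -/
def generalisedDeriv (f : E → F) (x : E) : Set (E →L[ℝ] F) :=
  convexHull ℝ (derivLimits f x)

end GeneralisedDerivative

section Frameworks

variable {V X : Type*} [NormedAddCommGroup X] [NormedSpace ℝ X]

/-- The length that a placement gives to an unordered pair of vertices. -/
def pairLength (p : V → X) : Sym2 V → ℝ :=
  Sym2.lift ⟨fun v w => ‖p v - p w‖, fun v w => norm_sub_rev (p v) (p w)⟩

/-- The rigidity map `p ↦ (‖p v - p w‖)_{vw}`, indexed by the edges `vw` of `G`. -/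
def rigidityMap (G : SimpleGraph V) (p : V → X) : G.edgeSet → ℝ :=
  fun e => pairLength p e

/-- Two frameworks with the same graph are equivalent if all their edge lengths agree. -/
def Equivalent (G : SimpleGraph V) (p q : V → X) : Prop :=
  ∀ v w, G.Adj v w → ‖p v - p w‖ = ‖q v - q w‖

/-- Two placements are congruent if an isometry of the normed space maps one to the other. -/
def Congruent (p q : V → X) : Prop :=
  ∃ g : X ≃ᵢ X, ∀ v, g (p v) = q v

/-- The tangent space at the identity of the isometry group of `X`: the velocities at time `0` of
smooth curves of isometries which start at the identity. As isometries of `X` are affine maps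
and `X` is finite-dimensional, a curve in the isometry group is smooth if and only if its
evaluation at each point of `X` is smooth. -/
def isomTangent (X : Type*) [NormedAddCommGroup X] [NormedSpace ℝ X] : Set (X → X) :=
  {g | ∃ c : ℝ → (X ≃ᵢ X), c 0 = IsometryEquiv.refl X ∧
    ∀ x, ContDiff ℝ ∞ (fun t => c t x) ∧ HasDerivAt (fun t => c t x) (g x) 0}

/-- The trivial infinitesimal flexes of a placement. -/
def trivialFlexes (p : V → X) : Set (V → X) :=
  {u | ∃ g ∈ isomTangent X, u = g ∘ p}

/-- `(G, p)` is locally rigid. -/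
def LocallyRigid (G : SimpleGraph V) (p : V → X) : Prop :=
  ∃ ε : ℝ, 0 < ε ∧ ∀ q : V → X, Equivalent G p q → (∀ v, ‖q v - p v‖ < ε) → Congruent p q

/-- `γ : [0,1] → X^V` is a continuous flex of `(G, p)`. -/
def IsContinuousFlex (G : SimpleGraph V) (p : V → X) (γ : unitInterval → (V → X)) : Prop :=
  Continuous γ ∧ γ 0 = p ∧ ∀ t, rigidityMap G (γ t) = rigidityMap G p

/-- `(G, p)` is continuously rigid: every continuous flex of it is trivial. -/
def ContinuouslyRigid (G : SimpleGraph V) (p : V → X) : Prop :=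
  ∀ γ : unitInterval → (V → X), IsContinuousFlex G p γ → ∀ t, Congruent (γ t) p

/-- `u` is an infinitesimal flex of `(G, p)`: the two-sided directional derivative of the
rigidity map at `p` in the direction `u` exists and is zero. -/
def IsInfinitesimalFlex (G : SimpleGraph V) (p u : V → X) : Prop :=
  Tendsto (fun t : ℝ => t⁻¹ • (rigidityMap G (p + t • u) - rigidityMap G p)) (𝓝[≠] 0) (𝓝 0)

/-- `(G, p)` is infinitesimally rigid: every infinitesimal flex of it is trivial. -/
def InfinitesimallyRigid (G : SimpleGraph V) (p : V → X) : Prop :=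
  ∀ u : V → X, IsInfinitesimalFlex G p u → u ∈ trivialFlexes p

variable [Fintype V]

/-- `(G, p)` is well-positioned: the rigidity map is Fréchet differentiable at `p`. -/
def WellPositioned (G : SimpleGraph V) [Fintype G.edgeSet] (p : V → X) : Prop :=
  DifferentiableAt ℝ (rigidityMap (X := X) G) p

/-- `(G, p)` is strongly infinitesimally rigid: the kernel of every generalised rigidity operator
consists of exactly the trivial infinitesimal flexes. -/
def StronglyInfinitesimallyRigid (G : SimpleGraph V) [Fintype G.edgeSet] (p : V → X) : Prop :=
  ∀ A ∈ generalisedDeriv (rigidityMap (X := X) G) p, {u : V → X | A u = 0} = trivialFlexes p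

end Frameworks

end BarJoint

/-!
Write `f` for the rigidity map of `G`, `A` for its derivative at `p`, and `T(q)` for the trivial
flexes of `q`.

Each component `q ↦ ‖q v - q w‖` of `f` is convex, and a convex function which is differentiable
at a point is strictly differentiable there (`ConvexOn.hasStrictFDerivAt`). Hence for every `c > 0`
the estimate `‖f x - f y - A (x - y)‖ ≤ c ‖x - y‖` holds for all `x`, `y` near `p`. Infinitesimal
rigidity says `ker A = T(p)`. Fix an inner product on the space of placements and call a
displacement normal to `q` if it is orthogonal to `T(q)`. As `A` is injective on the normal
displacements of `p` and the trivial flexes `g ∘ q` depend continuously on `q`, a compactness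
argument (`exists_lower_bound_normal`) gives `c > 0` with `2 c ‖w‖ ≤ ‖A w‖` for all `w` normal to
any `q` near `p`. These two estimates, collected in `NormalCoercive`, force a normal displacement
`w` with `‖A w‖ ≤ c ‖w‖` to vanish, and each kind of rigidity of `q` produces such a `w`.

* The generalised derivatives `B` of `f` at `q` satisfy `‖B - A‖ ≤ c` and vanish on `T(q)`. If
  `B u = 0`, then the component `w` of `u` normal to `T(q)` also satisfies `B w = 0`.
* If `u` is an infinitesimal flex of `q`, then so is its normal component `w`: although `f` need not
  be differentiable at `q`, it is Lipschitz and invariant under isometries, so adding a trivial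
  flex does not change the directional derivative. Strict differentiability gives
  `‖A w‖ ≤ c ‖w‖`.
* If `q'` is near `q` and has the same edge lengths, let `y` be the placement congruent to `q'`
  which is closest to `q`. The first-order condition for the minimum says that `w = y - q` is
  normal to `y`, and `f y = f q` gives `‖A w‖ ≤ c ‖w‖`. So `q = y` is congruent to `q'`.

Continuous rigidity follows from local rigidity: along a continuous flex, the set of times at which
the placement is congruent to the initial one is open, and closed because congruence classes are
closed.
-/

namespace BarJoint

/-! ### Strict differentiability of convex functions -/

section StrictDifferentiability

variable {E : Type*} [NormedAddCommGroup E] [NormedSpace ℝ E]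

/-- A convex function is strictly differentiable wherever it is differentiable: the remainder of
the first-order expansion is convex and `o(r)` on the ball of radius `r`, hence Lipschitz with
constant `o(1)` on the ball of radius `r / 2`. -/
theorem _root_.ConvexOn.hasStrictFDerivAt {f : E → ℝ} {f' : E →L[ℝ] ℝ} {x : E}
    (hf : ConvexOn ℝ Set.univ f) (h : HasFDerivAt f f' x) : HasStrictFDerivAt f f' x := by
  set φ : E → ℝ := fun y => f y - f x - f' (y - x) with hφ
  have hconv : ConvexOn ℝ Set.univ φ := by
    refine (hf.sub (((f' : E →ₗ[ℝ] ℝ).concaveOn convex_univ).add_const (f x - f' x))).congr ?_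
    intro y _
    simp [hφ]
    ring
  refine .of_isLittleO (Asymptotics.isLittleO_iff.2 fun c hc => ?_)
  have hev := Asymptotics.isLittleO_iff.1 h.isLittleO (show (0 : ℝ) < c / 4 by positivity)
  obtain ⟨r, hr, hball⟩ := Metric.eventually_nhds_iff.1 hev
  have hM : ∀ a, dist a x < r → |φ a| ≤ c / 4 * r := by
    intro a ha
    have h1 := hball ha
    rw [Real.norm_eq_abs] at h1
    refine h1.trans ?_
    rw [← dist_eq_norm]
    gcongr
  have hlip := (hconv.subset (Set.subset_univ (Metric.ball x r))
    (convex_ball x r)).lipschitzOnWith_of_abs_le (half_pos hr) hM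
  have hconst : 2 * (c / 4 * r) / (r / 2) = c := by field_simp; norm_num
  rw [hconst, sub_half] at hlip
  filter_upwards [prod_mem_nhds (Metric.ball_mem_nhds x (half_pos hr))
    (Metric.ball_mem_nhds x (half_pos hr))] with y hy
  have h2 := hlip.norm_sub_le hy.1 hy.2
  rw [Real.coe_toNNReal c hc.le] at h2
  convert h2 using 2
  simp only [hφ, map_sub]
  ring

/-- The derivative of a Lipschitz function along a curve depends only on the position and the
velocity of the curve, even where the function is not differentiable. -/
theorem _root_.LipschitzWith.hasDerivAt_comp_congr {E F : Type*} [NormedAddCommGroup E]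
    [NormedSpace ℝ E] [NormedAddCommGroup F] [NormedSpace ℝ F] {f : E → F} {K : NNReal}
    (hf : LipschitzWith K f) {y z : ℝ → E} {d : E} {f' : F} {t : ℝ} (hy : HasDerivAt y d t)
    (hz : HasDerivAt z d t) (hyz : y t = z t) (h : HasDerivAt (f ∘ y) f' t) :
    HasDerivAt (f ∘ z) f' t := by
  have h1 : HasDerivAt (fun s => z s - y s) 0 t := by simpa using hz.fun_sub hy
  have h2 : HasDerivAt (fun s => f (z s) - f (y s)) 0 t := by
    rw [hasDerivAt_iff_isLittleO] at h1 ⊢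
    refine Asymptotics.IsBigO.trans_isLittleO (.of_bound K (.of_forall fun s => ?_)) h1
    simpa [hyz] using hf.norm_sub_le (z s) (y s)
  refine (h.add h2).congr_deriv (add_zero f') |>.congr_of_eventuallyEq (.of_forall fun s => ?_)
  simp

end StrictDifferentiability

/-! ### Curves of isometries and their velocities -/

section Isometries

variable {X : Type*} [NormedAddCommGroup X] [NormedSpace ℝ X]

theorem coe_isometryEquiv_refl (Y : Type*) [PseudoEMetricSpace Y] :
    ⇑(IsometryEquiv.refl Y) = id := rfl

/-- Isometries are affine, by the Mazur–Ulam theorem. -/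
theorem isometryEquiv_apply_eq (h : X ≃ᵢ X) (x : X) :
    h x = h 0 + h.toRealLinearIsometryEquiv x := by
  simp

theorem isometryEquiv_sub (h : X ≃ᵢ X) (x y : X) :
    h x - h y = h.toRealLinearIsometryEquiv (x - y) := by
  simp only [map_sub, IsometryEquiv.toRealLinearIsometryEquiv_apply]
  abel

/-- A product rule for curves of isometries, which are only assumed to be differentiable
pointwise. -/
theorem hasDerivAt_isometry_apply {c : ℝ → X ≃ᵢ X} {g : X → X} (h0 : c 0 = IsometryEquiv.refl X)
    (hc : ∀ x, HasDerivAt (fun t => c t x) (g x) 0) {y : ℝ → X} {y' : X}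
    (hy : HasDerivAt y y' 0) : HasDerivAt (fun t => c t (y t)) (g (y 0) + y') 0 := by
  have hrest : HasDerivAt (fun t => c t (y t) - c t (y 0)) y' 0 := by
    rw [hasDerivAt_iff_tendsto_slope_zero] at hy ⊢
    have hcont : Tendsto (fun t => c t y' - c t 0) (𝓝[≠] 0) (𝓝 y') := by
      have h : Tendsto (fun t => c t y' - c t 0) (𝓝 0) (𝓝 (c 0 y' - c 0 0)) :=
        ((hc y').continuousAt.sub (hc 0).continuousAt).tendsto
      rw [h0, coe_isometryEquiv_refl, id, id, sub_zero] at h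
      exact h.mono_left nhdsWithin_le_nhds
    -- The linear part `L` of `c t` preserves distances, so `t⁻¹ • L (y t - y 0)` is as far from
    -- `L y'` as `t⁻¹ • (y t - y 0)` is from `y'`.
    refine tendsto_of_tendsto_of_dist hcont ?_
    have hdist : ∀ t : ℝ, dist (c t y' - c t 0)
        (t⁻¹ • (c (0 + t) (y (0 + t)) - c (0 + t) (y 0) - (c 0 (y 0) - c 0 (y 0)))) =
        dist y' (t⁻¹ • (y (0 + t) - y 0)) := by
      intro t
      rw [sub_self, sub_zero, zero_add, isometryEquiv_sub, isometryEquiv_sub, ← map_smul,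
        LinearIsometryEquiv.dist_map, sub_zero]
    simp only [hdist]
    simpa using (tendsto_const_nhds (x := y')).dist hy
  have := (hc (y 0)).add hrest
  refine this.congr_of_eventuallyEq (.of_forall fun t => ?_)
  simp

theorem contDiff_isometry_apply [FiniteDimensional ℝ X] {c : ℝ → X ≃ᵢ X}
    (hc : ∀ x, ContDiff ℝ ∞ (fun t => c t x)) {y : ℝ → X} (hy : ContDiff ℝ ∞ y) :
    ContDiff ℝ ∞ (fun t => c t (y t)) := by
  -- As `c t` is affine, `c t (y t)` is a combination of finitely many `c t x` with smooth
  -- coefficients.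
  let b := Module.finBasis ℝ X
  have h : (fun t => c t (y t)) =
      fun t => c t 0 + ∑ i, LinearMap.toContinuousLinearMap (b.coord i) (y t) •
        (c t (b i) - c t 0) := by
    funext t
    rw [isometryEquiv_apply_eq (c t) (y t)]
    nth_rewrite 1 [← b.sum_repr (y t)]
    rw [map_sum]
    simp only [map_smul, IsometryEquiv.toRealLinearIsometryEquiv_apply,
      LinearMap.coe_toContinuousLinearMap', Module.Basis.coord_apply]
  rw [h]
  refine (hc 0).add (ContDiff.sum fun i _ => ?_)
  exact ((ContinuousLinearMap.contDiff _).comp hy).smul ((hc (b i)).sub (hc 0))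

theorem zero_mem_isomTangent : (0 : X → X) ∈ isomTangent X :=
  ⟨fun _ => IsometryEquiv.refl X, rfl, fun x => ⟨contDiff_const, hasDerivAt_const 0 x⟩⟩

theorem add_mem_isomTangent [FiniteDimensional ℝ X] {g h : X → X} (hg : g ∈ isomTangent X)
    (hh : h ∈ isomTangent X) : g + h ∈ isomTangent X := by
  obtain ⟨c, hc0, hc⟩ := hg
  obtain ⟨d, hd0, hd⟩ := hh
  refine ⟨fun t => (d t).trans (c t), by simp [hc0, hd0]; rfl, fun x => ⟨?_, ?_⟩⟩
  · exact contDiff_isometry_apply (fun x => (hc x).1) (hd x).1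
  · have := hasDerivAt_isometry_apply hc0 (fun x => (hc x).2) (hd x).2
    simpa [hd0, coe_isometryEquiv_refl] using this

theorem smul_mem_isomTangent {g : X → X} (a : ℝ) (hg : g ∈ isomTangent X) :
    a • g ∈ isomTangent X := by
  obtain ⟨c, hc0, hc⟩ := hg
  refine ⟨fun t => c (a * t), by simpa using hc0, fun x => ⟨?_, ?_⟩⟩
  · exact (hc x).1.comp (contDiff_const.mul contDiff_id)
  · have h1 : HasDerivAt (fun t : ℝ => a * t) a 0 := by
      simpa using (hasDerivAt_id (0 : ℝ)).const_mul a
    have h2 := (hc x).2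
    rw [← mul_zero a] at h2
    exact h2.scomp (0 : ℝ) h1

theorem continuous_of_mem_isomTangent [FiniteDimensional ℝ X] {g : X → X}
    (hg : g ∈ isomTangent X) : Continuous g := by
  obtain ⟨c, -, hc⟩ := hg
  have hd : ∀ x, HasDerivAt (fun t => (c t).toRealLinearIsometryEquiv x) (g x - g 0) 0 := by
    intro x
    simpa using (hc x).2.fun_sub (hc 0).2
  let l : X →ₗ[ℝ] X :=
    { toFun := fun x => g x - g 0
      map_add' := fun x y => (hd (x + y)).unique (by
        simpa only [map_add] using (hd x).fun_add (hd y))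
      map_smul' := fun a x => (hd (a • x)).unique (by
        simpa only [map_smul, RingHom.id_apply] using (hd x).fun_const_smul a) }
  have : g = fun x => l x + g 0 := by
    funext x
    simp [l]
  rw [this]
  exact l.continuous_of_finiteDimensional.add continuous_const

end Isometries

/-! ### Congruence and trivial flexes -/

section Frameworks

variable {V X : Type*} [NormedAddCommGroup X]

theorem Congruent.refl (p : V → X) : Congruent p p := ⟨IsometryEquiv.refl X, fun _ => rfl⟩

theorem Congruent.symm {p q : V → X} (h : Congruent p q) : Congruent q p := by
  obtain ⟨g, hg⟩ := h
  exact ⟨g.symm, fun v => by rw [← hg, g.symm_apply_apply]⟩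

theorem Congruent.trans {p q r : V → X} (h : Congruent p q) (h' : Congruent q r) :
    Congruent p r := by
  obtain ⟨g, hg⟩ := h
  obtain ⟨k, hk⟩ := h'
  exact ⟨g.trans k, fun v => by rw [← hk, ← hg]; rfl⟩

theorem rigidityMap_eq_iff (G : SimpleGraph V) (p q : V → X) :
    rigidityMap G p = rigidityMap G q ↔ Equivalent G p q := by
  constructor
  · intro h v w hvw
    exact congrFun h ⟨s(v, w), hvw⟩
  · intro h
    funext ⟨e, he⟩
    induction e with
    | h v w => exact h v w he

theorem Congruent.rigidityMap_eq (G : SimpleGraph V) {p q : V → X} (h : Congruent p q) :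
    rigidityMap G p = rigidityMap G q := by
  obtain ⟨g, hg⟩ := h
  rw [rigidityMap_eq_iff]
  intro v w _
  rw [← hg, ← hg, ← dist_eq_norm, ← dist_eq_norm, g.dist_eq]

theorem lipschitzWith_rigidityMap [Fintype V] (G : SimpleGraph V) [Fintype G.edgeSet] :
    LipschitzWith 2 (rigidityMap (X := X) G) := by
  refine LipschitzWith.of_dist_le_mul fun p q => (dist_pi_le_iff (by positivity)).2 ?_
  rintro ⟨e, he⟩
  induction e with
  | h v w =>
    change dist ‖p v - p w‖ ‖q v - q w‖ ≤ _
    have h1 := dist_le_pi_dist p q v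
    have h2 := dist_le_pi_dist p q w
    have h3 := (dist_norm_norm_le (p v - p w) (q v - q w)).trans
      ((dist_eq_norm _ _).symm.le.trans (dist_sub_sub_le (p v) (p w) (q v) (q w)))
    push_cast
    linarith

variable [NormedSpace ℝ X]

/-- The trivial infinitesimal flexes of a placement, as a linear subspace. -/
def trivialFlexSubmodule [FiniteDimensional ℝ X] (p : V → X) : Submodule ℝ (V → X) where
  carrier := trivialFlexes p
  zero_mem' := ⟨0, zero_mem_isomTangent, rfl⟩
  add_mem' := by
    rintro _ _ ⟨g, hg, rfl⟩ ⟨h, hh, rfl⟩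
    exact ⟨g + h, add_mem_isomTangent hg hh, rfl⟩
  smul_mem' := by
    rintro a _ ⟨g, hg, rfl⟩
    exact ⟨a • g, smul_mem_isomTangent a hg, rfl⟩

theorem hasDerivAt_isometry_comp {c : ℝ → X ≃ᵢ X} {g : X → X}
    (h0 : c 0 = IsometryEquiv.refl X) (hc : ∀ x, HasDerivAt (fun t => c t x) (g x) 0)
    {y : ℝ → V → X} {y' : V → X} (hy : HasDerivAt y y' 0) :
    HasDerivAt (fun t => c t ∘ y t) (g ∘ y 0 + y') 0 :=
  hasDerivAt_pi.2 fun v => hasDerivAt_isometry_apply h0 hc (hasDerivAt_pi.1 hy v)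

theorem isInfinitesimalFlex_iff {G : SimpleGraph V} [Fintype G.edgeSet] {p u : V → X} :
    IsInfinitesimalFlex G p u ↔ HasDerivAt (fun t : ℝ => rigidityMap G (p + t • u)) 0 0 := by
  rw [hasDerivAt_iff_tendsto_slope_zero]
  simp [IsInfinitesimalFlex]

/-- Congruence classes are closed: they are the sum of a compact set, the image of the linear
isometries, and the linear subspace of translations. -/
theorem isClosed_setOf_congruent [FiniteDimensional ℝ X] (p : V → X) :
    IsClosed {q : V → X | Congruent p q} := by
  let S : Set (X →L[ℝ] X) := {L | ∀ x, ‖L x‖ = ‖x‖}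
  have hS : IsCompact S := by
    have := FiniteDimensional.proper ℝ (X →L[ℝ] X)
    refine (isCompact_closedBall (0 : X →L[ℝ] X) 1).of_isClosed_subset ?_ fun L hL => ?_
    · simp only [S, Set.ofPred_forall]
      exact isClosed_iInter fun x => isClosed_eq (by fun_prop) continuous_const
    · rw [mem_closedBall_zero_iff]
      exact L.opNorm_le_bound zero_le_one fun x => by rw [hL x, one_mul]
  have hS' : IsCompact ((fun (L : X →L[ℝ] X) (v : V) => L (p v)) '' S) :=
    hS.image (by fun_prop)
  let T : Submodule ℝ (V → X) :=
    LinearMap.range (LinearMap.pi fun _ : V => (LinearMap.id : X →ₗ[ℝ] X))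
  have hT : IsClosed (T : Set (V → X)) := T.closed_of_finiteDimensional
  convert hT.add_left_of_isCompact hS' using 1
  ext q
  simp only [Set.mem_ofPred_eq, Set.mem_add]
  constructor
  · rintro ⟨h, hh⟩
    refine ⟨_, ⟨(h.toRealLinearIsometryEquiv.toContinuousLinearEquiv : X →L[ℝ] X),
      fun x => h.toRealLinearIsometryEquiv.norm_map x, rfl⟩, fun _ => h 0, ⟨h 0, rfl⟩, ?_⟩
    funext v
    simp [← hh]
  · rintro ⟨_, ⟨L, hL, rfl⟩, _, ⟨b, rfl⟩, rfl⟩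
    let L' : X →ₗᵢ[ℝ] X := ⟨L, hL⟩
    exact ⟨(L'.toLinearIsometryEquiv rfl).toIsometryEquiv.trans (IsometryEquiv.addRight b),
      fun v => rfl⟩

/-! ### Derivatives of the rigidity map -/

variable [Fintype V]

theorem hasStrictFDerivAt_rigidityMap {G : SimpleGraph V} [Fintype G.edgeSet] {p : V → X}
    (hwp : WellPositioned G p) :
    HasStrictFDerivAt (rigidityMap (X := X) G) (fderiv ℝ (rigidityMap (X := X) G) p) p := by
  refine hasStrictFDerivAt_pi'.2 fun e => ConvexOn.hasStrictFDerivAt ?_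
    (hasFDerivAt_pi'.1 hwp.hasFDerivAt e)
  obtain ⟨e, he⟩ := e
  induction e with
  | h v w =>
    have := (convexOn_univ_norm (E := X)).comp_linearMap
      (LinearMap.proj (R := ℝ) (φ := fun _ : V => X) v - LinearMap.proj w)
    simpa using! this

theorem fderiv_rigidityMap_trivial {G : SimpleGraph V} [Fintype G.edgeSet] {x : V → X}
    (hx : DifferentiableAt ℝ (rigidityMap (X := X) G) x) {g : X → X} (hg : g ∈ isomTangent X) :
    fderiv ℝ (rigidityMap (X := X) G) x (g ∘ x) = 0 := by
  obtain ⟨c, h0, hc⟩ := hg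
  have hcurve := hasDerivAt_isometry_comp h0 (fun x => (hc x).2)
    (hasDerivAt_const (0 : ℝ) x)
  rw [add_zero] at hcurve
  have hx' : HasFDerivAt (rigidityMap (X := X) G) (fderiv ℝ (rigidityMap (X := X) G) x)
      (c 0 ∘ x) := by
    rw [h0]
    exact hx.hasFDerivAt
  have h1 := hx'.comp_hasDerivAt (0 : ℝ) hcurve
  have h2 : (rigidityMap (X := X) G) ∘ (fun t => c t ∘ x) = fun _ => rigidityMap G x := by
    funext t
    exact (Congruent.rigidityMap_eq G ⟨c t, fun _ => rfl⟩).symm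
  rw [h2] at h1
  exact h1.unique (hasDerivAt_const _ _)

/-- Generalised derivatives vanish on trivial flexes. Along `x n → q` the trivial flexes `g ∘ x n`
converge to `g ∘ q`, since velocities `g` of isometries are continuous. -/
theorem generalisedDeriv_trivial [FiniteDimensional ℝ X] {G : SimpleGraph V} [Fintype G.edgeSet]
    {q : V → X} {A : (V → X) →L[ℝ] (G.edgeSet → ℝ)}
    (hA : A ∈ generalisedDeriv (rigidityMap (X := X) G) q) {u : V → X}
    (hu : u ∈ trivialFlexes q) : A u = 0 := by
  obtain ⟨g, hg, rfl⟩ := hu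
  have hconv : Convex ℝ {B : (V → X) →L[ℝ] (G.edgeSet → ℝ) | B (g ∘ q) = 0} := by
    intro B hB C hC a b _ _ _
    simp only [Set.mem_ofPred_eq] at hB hC ⊢
    simp [hB, hC]
  refine convexHull_min ?_ hconv hA
  rintro B ⟨x, hx, hdiff, hB⟩
  have hgc := continuous_of_mem_isomTangent hg
  have hcomp : Tendsto (fun n => g ∘ x n) atTop (𝓝 (g ∘ q)) :=
    tendsto_pi_nhds.2 fun v => (hgc.tendsto _).comp (tendsto_pi_nhds.1 hx v)
  have hlim : Tendsto (fun n => fderiv ℝ (rigidityMap (X := X) G) (x n) (g ∘ x n)) atTop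
      (𝓝 (B (g ∘ q))) :=
    (isBoundedBilinearMap_apply.continuous.tendsto (B, g ∘ q)).comp (hB.prodMk_nhds hcomp)
  simp only [fderiv_rigidityMap_trivial (hdiff _) hg] at hlim
  exact tendsto_nhds_unique hlim tendsto_const_nhds

/-- The curves `t ↦ c t ∘ (q + t • u)` and `t ↦ q + t • (g ∘ q + u)`, where `g` is the velocity of
`c`, agree to first order, and along the former the edge lengths are those of `q + t • u`. -/
theorem IsInfinitesimalFlex.add_trivial {G : SimpleGraph V} [Fintype G.edgeSet] {q u w : V → X}
    (hu : IsInfinitesimalFlex G q u) (hw : w ∈ trivialFlexes q) :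
    IsInfinitesimalFlex G q (w + u) := by
  rw [isInfinitesimalFlex_iff] at hu ⊢
  obtain ⟨g, ⟨c, h0, hc⟩, rfl⟩ := hw
  have hline : ∀ d : V → X, HasDerivAt (fun t : ℝ => q + t • d) d 0 := by
    intro d
    simpa using ((hasDerivAt_id (0 : ℝ)).smul_const d).const_add q
  have hcurve := hasDerivAt_isometry_comp h0 (fun x => (hc x).2) (hline u)
  simp only [zero_smul, add_zero] at hcurve
  refine (lipschitzWith_rigidityMap G).hasDerivAt_comp_congr hcurve (hline _)
    (by simp [h0, coe_isometryEquiv_refl]) ?_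
  refine hu.congr_of_eventuallyEq (.of_forall fun t => ?_)
  exact (Congruent.rigidityMap_eq G ⟨c t, fun _ => rfl⟩).symm

/-! ### Displacements normal to the trivial flexes -/

/-- A displacement `w` is normal to the placement `q` if it is orthogonal to the trivial flexes of
`q`. Orthogonality refers to the inner product which the linear identification `toEuclidean` induces
on the space of placements; any inner product would do. -/
def IsNormal (q w : V → X) [FiniteDimensional ℝ X] : Prop :=
  ∀ u ∈ trivialFlexes q, inner ℝ (toEuclidean u) (toEuclidean w) = 0

theorem exists_trivial_add_normal [FiniteDimensional ℝ X] (q u : V → X) :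
    ∃ τ ∈ trivialFlexes q, ∃ w, IsNormal q w ∧ u = τ + w := by
  let K := (trivialFlexSubmodule q).map (toEuclidean (E := V → X)).toLinearEquiv.toLinearMap
  obtain ⟨y, ⟨τ, hτ, rfl⟩, z, hz, h⟩ := K.exists_add_mem_mem_orthogonal (toEuclidean u)
  refine ⟨τ, hτ, u - τ, fun t ht => ?_, by simp⟩
  have hz' : toEuclidean (u - τ) = z := by
    rw [map_sub, h]
    simp
  rw [hz']
  exact (Submodule.mem_orthogonal K z).1 hz _ ⟨t, ht, rfl⟩

/-- If every element of `ker A` is a trivial flex of `p`, then `A` is bounded below on the normal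
displacements, uniformly for all placements near `p`. -/
theorem exists_lower_bound_normal [FiniteDimensional ℝ X] {F : Type*} [NormedAddCommGroup F]
    [NormedSpace ℝ F] {p : V → X} (A : (V → X) →L[ℝ] F)
    (hA : ∀ u, A u = 0 → u ∈ trivialFlexes p) :
    ∃ c : ℝ, 0 < c ∧ ∀ᶠ q in 𝓝 p, ∀ w, IsNormal q w → c * ‖w‖ ≤ ‖A w‖ := by
  suffices h : ∃ c : ℝ, 0 < c ∧ ∀ᶠ q in 𝓝 p, ∀ w ∈ Metric.sphere (0 : V → X) 1,
      IsNormal q w → c ≤ ‖A w‖ by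
    obtain ⟨c, hc, h⟩ := h
    refine ⟨c, hc, h.mono fun q hq w hw => ?_⟩
    rcases eq_or_ne w 0 with rfl | hw0
    · simp
    have hpos : 0 < ‖w‖ := norm_pos_iff.2 hw0
    have h1 := hq (‖w‖⁻¹ • w) (by simp [norm_smul, hpos.ne']) fun u hu => by
      rw [map_smul, inner_smul_right, hw u hu, mul_zero]
    rw [map_smul, norm_smul, norm_inv, norm_norm] at h1
    rwa [← le_div_iff₀ hpos, div_eq_inv_mul]
  -- By compactness it suffices to bound `A` below near each unit vector `w₀`. If `A w₀ = 0`, then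
  -- `w₀ = g ∘ p` is a trivial flex of `p`, and no `w` near `w₀` is normal to a `q` near `p`.
  refine (isCompact_sphere (0 : V → X) 1).induction_on
    (p := fun s => ∃ c : ℝ, 0 < c ∧ ∀ᶠ q in 𝓝 p, ∀ w ∈ s, IsNormal q w → c ≤ ‖A w‖) ?_ ?_ ?_ ?_
  · exact ⟨1, one_pos, .of_forall fun q w hw => hw.elim⟩
  · rintro s t hst ⟨c, hc, h⟩
    exact ⟨c, hc, h.mono fun q hq w hw => hq w (hst hw)⟩
  · rintro s t ⟨c, hc, h⟩ ⟨d, hd, h'⟩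
    refine ⟨min c d, lt_min hc hd, (h.and h').mono fun q hq w hw hn => ?_⟩
    rcases hw with hw | hw
    · exact (min_le_left _ _).trans (hq.1 w hw hn)
    · exact (min_le_right _ _).trans (hq.2 w hw hn)
  · intro w₀ hw₀
    rcases eq_or_ne (A w₀) 0 with h0 | h0
    · obtain ⟨g, hg, hgw⟩ := hA w₀ h0
      have hgc := continuous_of_mem_isomTangent hg
      have hcont : Continuous fun z : (V → X) × (V → X) =>
          inner ℝ (toEuclidean (g ∘ z.1)) (toEuclidean z.2) := by
        have : Continuous fun z : (V → X) × (V → X) => g ∘ z.1 :=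
          continuous_pi fun v => hgc.comp ((continuous_apply v).comp continuous_fst)
        exact (toEuclidean.continuous.comp this).inner (toEuclidean.continuous.comp continuous_snd)
      have hne : inner ℝ (toEuclidean (g ∘ p)) (toEuclidean w₀) ≠ 0 := by
        rw [← hgw, inner_self_ne_zero]
        intro h
        rw [EmbeddingLike.map_eq_zero_iff] at h
        simp [h] at hw₀
      have hev : ∀ᶠ z in 𝓝 (p, w₀), inner ℝ (toEuclidean (g ∘ z.1)) (toEuclidean z.2) ≠ 0 :=
        hcont.continuousAt.eventually_ne hne
      rw [nhds_prod_eq] at hev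
      obtain ⟨P, hP, Q, hQ, hPQ⟩ := eventually_prod_iff.1 hev
      exact ⟨{w | Q w}, mem_nhdsWithin_of_mem_nhds hQ, 1, one_pos,
        hP.mono fun q hq w hw hn => (hPQ hq hw (hn _ ⟨g, hg, rfl⟩)).elim⟩
    · have hpos : 0 < ‖A w₀‖ := norm_pos_iff.2 h0
      refine ⟨{w | ‖A w₀‖ / 2 < ‖A w‖}, mem_nhdsWithin_of_mem_nhds ?_, ‖A w₀‖ / 2, half_pos hpos,
        .of_forall fun q w hw _ => le_of_lt hw⟩
      exact (A.continuous.norm.tendsto w₀).eventually_const_lt (half_lt_self hpos)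

/-- The placement `y` congruent to `q'` which is closest to `q` differs from `q` by a displacement
normal to `y`: moving `y` by a curve of isometries cannot decrease the distance to `q`. -/
theorem exists_congruent_normal [FiniteDimensional ℝ X] (q q' : V → X) :
    ∃ y, Congruent q' y ∧ IsNormal y (y - q) ∧
      ‖toEuclidean (y - q)‖ ≤ ‖toEuclidean (q' - q)‖ := by
  have hcl : IsClosed (toEuclidean '' {y : V → X | Congruent q' y}) :=
    toEuclidean.toHomeomorph.isClosedMap _ (isClosed_setOf_congruent q')
  obtain ⟨_, ⟨y, hy, rfl⟩, hmin⟩ := hcl.exists_infDist_eq_dist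
    ⟨_, q', Congruent.refl q', rfl⟩ (toEuclidean q)
  have hle : ∀ z, Congruent q' z → ‖toEuclidean (y - q)‖ ≤ ‖toEuclidean (z - q)‖ := by
    intro z hz
    rw [map_sub, map_sub, ← dist_eq_norm, ← dist_eq_norm, dist_comm, ← hmin, dist_comm]
    exact Metric.infDist_le_dist_of_mem ⟨z, hz, rfl⟩
  refine ⟨y, hy, ?_, hle q' (Congruent.refl q')⟩
  rintro _ ⟨g, ⟨c, h0, hc⟩, rfl⟩
  have hcurve := (hasDerivAt_isometry_comp h0 (fun x => (hc x).2)
    (hasDerivAt_const (0 : ℝ) y)).sub_const q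
  rw [add_zero] at hcurve
  have h1 := ((toEuclidean (E := V → X)).hasFDerivAt.comp_hasDerivAt (0 : ℝ) hcurve).norm_sq
  have hlm : IsLocalMin
      (fun t : ℝ => ‖((toEuclidean (E := V → X)) ∘ fun t => c t ∘ y - q) t‖ ^ 2) 0 := by
    refine .of_forall fun t => ?_
    have := hle (c t ∘ y) (hy.trans ⟨c t, fun _ => rfl⟩)
    simp only [Function.comp_apply, h0]
    gcongr
    exact this
  have h2 := hlm.hasDerivAt_eq_zero h1
  rw [real_inner_comm]
  simpa [h0, coe_isometryEquiv_refl] using h2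

/-! ### Rigidity of nearby placements -/

theorem continuouslyRigid_of_locallyRigid [FiniteDimensional ℝ X] {G : SimpleGraph V}
    [Fintype G.edgeSet] {q : V → X} (h : LocallyRigid G q) : ContinuouslyRigid G q := by
  rintro γ ⟨hγ, h0, hlen⟩ t
  obtain ⟨δ, hδ, h⟩ := h
  have hclosed : IsClosed {t | Congruent q (γ t)} := (isClosed_setOf_congruent q).preimage hγ
  have hopen : IsOpen {t | Congruent q (γ t)} := by
    rw [isOpen_iff_mem_nhds]
    rintro s ⟨g, hg⟩
    filter_upwards [hγ.continuousAt.preimage_mem_nhds (Metric.ball_mem_nhds (γ s) hδ)] with r hr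
    -- Pull `γ r` back to a placement near `q` by the isometry `g` that takes `q` to `γ s`.
    have hback : Congruent (γ r) (g.symm ∘ γ r) := ⟨g.symm, fun _ => rfl⟩
    refine (h (g.symm ∘ γ r) ?_ fun v => ?_).trans hback.symm
    · rw [← rigidityMap_eq_iff, ← hback.rigidityMap_eq, hlen]
    · rw [← dist_eq_norm, ← g.dist_eq, hg, Function.comp_apply, g.apply_symm_apply]
      exact (dist_pi_lt_iff hδ).1 hr v
  have huniv := IsClopen.eq_univ ⟨hclosed, hopen⟩
    ⟨0, show Congruent q (γ 0) by rw [h0]; exact Congruent.refl q⟩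
  have ht : t ∈ {t | Congruent q (γ t)} := by rw [huniv]; trivial
  exact Congruent.symm ht

/-- On the ball of radius `r` around `p`, the linear map `A` approximates the rigidity map up to a
`c`-Lipschitz error, and is bounded below by `2 * c` on the displacements normal to any placement in
that ball. -/
structure NormalCoercive [FiniteDimensional ℝ X] (G : SimpleGraph V) [Fintype G.edgeSet]
    (A : (V → X) →L[ℝ] (G.edgeSet → ℝ)) (c : ℝ) (p : V → X) (r : ℝ) : Prop where
  pos : 0 < c
  approx : ∀ x ∈ Metric.ball p r, ∀ y ∈ Metric.ball p r,
    ‖rigidityMap G x - rigidityMap G y - A (x - y)‖ ≤ c * ‖x - y‖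
  coercive : ∀ q ∈ Metric.ball p r, ∀ w, IsNormal q w → 2 * c * ‖w‖ ≤ ‖A w‖

namespace NormalCoercive

variable [FiniteDimensional ℝ X] {G : SimpleGraph V} [Fintype G.edgeSet]
  {A : (V → X) →L[ℝ] (G.edgeSet → ℝ)} {c : ℝ} {p : V → X} {r : ℝ}

theorem eq_zero (h : NormalCoercive G A c p r) {q w : V → X} (hq : q ∈ Metric.ball p r)
    (hn : IsNormal q w) (hw : ‖A w‖ ≤ c * ‖w‖) : w = 0 := by
  have h1 := h.coercive q hq w hn
  have h2 : c * ‖w‖ ≤ 0 := by linarith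
  exact norm_le_zero_iff.1 (nonpos_of_mul_nonpos_right h2 h.pos)

theorem norm_generalisedDeriv_sub_le (h : NormalCoercive G A c p r) {q : V → X}
    (hq : q ∈ Metric.ball p r) {B : (V → X) →L[ℝ] (G.edgeSet → ℝ)}
    (hB : B ∈ generalisedDeriv (rigidityMap (X := X) G) q) : ‖B - A‖ ≤ c := by
  rw [← mem_closedBall_iff_norm]
  refine convexHull_min ?_ (convex_closedBall A c) hB
  rintro C ⟨x, hx, hdiff, hC⟩
  refine Metric.isClosed_closedBall.mem_of_tendsto hC ?_
  filter_upwards [hx.eventually (Metric.isOpen_ball.mem_nhds hq)] with n hn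
  rw [mem_closedBall_iff_norm]
  have hlip : LipschitzOnWith c.toNNReal (fun y => rigidityMap G y - A y) (Metric.ball p r) := by
    refine LipschitzOnWith.of_dist_le_mul fun y hy z hz => ?_
    rw [Real.coe_toNNReal c h.pos.le, dist_eq_norm, dist_eq_norm]
    refine le_of_eq_of_le ?_ (h.approx y hy z hz)
    rw [map_sub]
    congr 1
    abel
  have := ((hdiff n).hasFDerivAt.sub A.hasFDerivAt).le_of_lipschitzOn
    (Metric.isOpen_ball.mem_nhds hn) hlip
  rwa [Real.coe_toNNReal c h.pos.le] at this

theorem stronglyInfinitesimallyRigid (h : NormalCoercive G A c p r) {q : V → X}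
    (hq : q ∈ Metric.ball p r) : StronglyInfinitesimallyRigid G q := by
  intro B hB
  ext u
  refine ⟨fun hu => ?_, fun hu => generalisedDeriv_trivial hB hu⟩
  obtain ⟨τ, hτ, w, hw, rfl⟩ := exists_trivial_add_normal q u
  have hBw : B w = 0 := by
    simpa [generalisedDeriv_trivial hB hτ] using hu
  have hw0 : w = 0 := by
    refine h.eq_zero hq hw ?_
    have h1 := (B - A).le_of_opNorm_le (h.norm_generalisedDeriv_sub_le hq hB) w
    simpa [hBw] using h1
  simpa [hw0] using hτ

theorem infinitesimallyRigid (h : NormalCoercive G A c p r) {q : V → X}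
    (hq : q ∈ Metric.ball p r) : InfinitesimallyRigid G q := by
  intro u hu
  obtain ⟨τ, hτ, w, hw, rfl⟩ := exists_trivial_add_normal q u
  have hflex : IsInfinitesimalFlex G q w := by
    have := hu.add_trivial ((trivialFlexSubmodule q).neg_mem hτ)
    rwa [neg_add_cancel_left] at this
  have hw0 : w = 0 := by
    refine h.eq_zero hq hw ?_
    have hlim := (Tendsto.sub_const hflex (A w)).norm
    rw [zero_sub, norm_neg] at hlim
    refine le_of_tendsto hlim ?_
    have hline : Tendsto (fun t : ℝ => q + t • w) (𝓝[≠] 0) (𝓝 q) := by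
      have : Continuous fun t : ℝ => q + t • w := by fun_prop
      simpa using (this.tendsto 0).mono_left nhdsWithin_le_nhds
    filter_upwards [hline.eventually (Metric.isOpen_ball.mem_nhds hq), self_mem_nhdsWithin]
      with t ht ht0
    have ht0 : t ≠ 0 := ht0
    have h1 := h.approx _ ht _ hq
    rw [add_sub_cancel_left, map_smul, norm_smul] at h1
    have h2 : t⁻¹ • (rigidityMap G (q + t • w) - rigidityMap G q) - A w =
        t⁻¹ • (rigidityMap G (q + t • w) - rigidityMap G q - t • A w) := by
      rw [smul_sub _ (_ - _), inv_smul_smul₀ ht0]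
    rw [h2, norm_smul, norm_inv, inv_mul_le_iff₀ (norm_pos_iff.2 ht0)]
    linarith
  simpa [hw0] using hτ

theorem locallyRigid (h : NormalCoercive G A c p r) {q : V → X}
    (hq : q ∈ Metric.ball p r) : LocallyRigid G q := by
  obtain ⟨δ, hδ, hball⟩ := Metric.isOpen_iff.1 Metric.isOpen_ball q hq
  have hev1 : ∀ᶠ z in 𝓝 (0 : EuclideanSpace ℝ (Fin (Module.finrank ℝ (V → X)))),
      (toEuclidean (E := V → X)).symm z ∈ Metric.ball 0 δ := by
    refine (toEuclidean (E := V → X)).symm.continuous.continuousAt.preimage_mem_nhds ?_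
    rw [map_zero]
    exact Metric.ball_mem_nhds _ hδ
  obtain ⟨η, hη, hη'⟩ := Metric.eventually_nhds_iff.1 hev1
  have hev2 : ∀ᶠ z in 𝓝 q, ‖toEuclidean (z - q)‖ < η := by
    have : Continuous fun z : V → X => ‖toEuclidean (z - q)‖ := by fun_prop
    exact (this.tendsto q).eventually_lt_const (by simpa using hη)
  obtain ⟨ε, hε, hε'⟩ := Metric.eventually_nhds_iff.1 hev2
  refine ⟨ε, hε, fun q' heq hclose => ?_⟩
  obtain ⟨y, hy, hn, hle⟩ := exists_congruent_normal q q'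
  have hyb : y ∈ Metric.ball p r := by
    refine hball ?_
    have h1 := hη' (y := toEuclidean (y - q)) (by
      rw [dist_zero_right]
      exact hle.trans_lt (hε' ((dist_pi_lt_iff hε).2 fun v => by
        rw [dist_eq_norm]; exact hclose v)))
    simpa [dist_eq_norm] using h1
  have hyq : y - q = 0 := by
    refine h.eq_zero hyb hn ?_
    have h1 := h.approx y hyb q hq
    rwa [← hy.rigidityMap_eq, ← (rigidityMap_eq_iff G q q').2 heq, sub_self, zero_sub,
      norm_neg] at h1
  rw [sub_eq_zero] at hyq
  exact hyq ▸ hy.symm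

end NormalCoercive

theorem exists_normalCoercive [FiniteDimensional ℝ X] {G : SimpleGraph V} [Fintype G.edgeSet]
    {p : V → X} (hwp : WellPositioned G p) (hrigid : InfinitesimallyRigid G p) :
    ∃ c r : ℝ, 0 < r ∧
      NormalCoercive G (fderiv ℝ (rigidityMap (X := X) G) p) c p r := by
  have hstrict := hasStrictFDerivAt_rigidityMap hwp
  have hker : ∀ u, fderiv ℝ (rigidityMap (X := X) G) p u = 0 → u ∈ trivialFlexes p := by
    intro u hu
    refine hrigid u (isInfinitesimalFlex_iff.2 ?_)
    rw [← hu]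
    exact hwp.hasFDerivAt.hasLineDerivAt u
  obtain ⟨c, hc, hcoer⟩ := exists_lower_bound_normal _ hker
  have happ := Asymptotics.isLittleO_iff.1 hstrict.isLittleO (half_pos hc)
  obtain ⟨r, hr, hr'⟩ := Metric.eventually_nhds_iff.1 happ
  obtain ⟨s, hs, hs'⟩ := Metric.eventually_nhds_iff.1 hcoer
  refine ⟨c / 2, min r s, lt_min hr hs, half_pos hc, fun x hx y hy => ?_, fun q hq w hw => ?_⟩
  · exact hr' (y := (x, y)) (max_lt (lt_of_lt_of_le hx (min_le_left _ _))
      (lt_of_lt_of_le hy (min_le_left _ _)))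
  · have := hs' (lt_of_lt_of_le hq (min_le_right _ _)) w hw
    linarith

end Frameworks

end BarJoint

theorem mainTheorem3 {V X : Type*} [Fintype V] [NormedAddCommGroup X] [NormedSpace ℝ X]
    [FiniteDimensional ℝ X] (G : SimpleGraph V) [Fintype G.edgeSet] (p : V → X)
    (hwp : BarJoint.WellPositioned G p) (hrigid : BarJoint.InfinitesimallyRigid G p) :
    ∃ ε : ℝ, 0 < ε ∧ ∀ q : V → X, (∀ v, ‖p v - q v‖ < ε) →
      BarJoint.StronglyInfinitesimallyRigid G q ∧ BarJoint.InfinitesimallyRigid G q ∧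
        BarJoint.LocallyRigid G q ∧ BarJoint.ContinuouslyRigid G q := by
  obtain ⟨c, r, hr, h⟩ := BarJoint.exists_normalCoercive hwp hrigid
  refine ⟨r, hr, fun q hq => ?_⟩
  have hqb : q ∈ Metric.ball p r := by
    rw [Metric.mem_ball', dist_pi_lt_iff hr]
    exact fun v => by rw [dist_eq_norm]; exact hq v
  exact ⟨h.stronglyInfinitesimallyRigid hqb, h.infinitesimallyRigid hqb, h.locallyRigid hqb,
    BarJoint.continuouslyRigid_of_locallyRigid (h.locallyRigid hqb)⟩
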